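/- Let $\Omega=\{0,1\}^{\mathbb N}$ be the Cantor space, write $[a]\subset\Omega$ for the set of all infinite extensions of a finite binary string $a$, let $P$ be a computable probability measure on $\Omega\times\Omega$ (the values $P([a]\times[b])$ are computable reals uniformly in $a,b$), and let $P_1$ be its marginal distribution on the first coordinate. For $\alpha\in\Omega$ the conditional distribution $P(\cdot\,|\,\alpha)$ is the measure on $\Omega$ with $$P([b]\,|\,\alpha)=\lim_{n\to\infty}\frac{P([a_n]\times[b])}{P_1([a_n])}\quad\text{for all finite strings } b,$$ where $a_n$ is the prefix of $\alpha$ of length $n$ and all $P_1([a_n])$ are required to be positive; it is unique if it exists. (It exists for every $P_1$-random $\alpha$; where it does not exist, no sequence is regarded as random with respect to it.) A test with respect to a measure $\mu$ (with oracle $\alpha$) is a sequence of open sets $U_n$, effectively open (with oracle $\alpha$) uniformly in $n$, such that $\mu(U_n)\le 2^{-n}$ for all $n$; no access to $\mu$ is given. A point is $\mu$-random if for every such test it lies outside $\bigcap_n U_n$. For a computable $\mu$ and no oracle this is Martin-Löf randomness; for an arbitrary, possibly noncomputable, $\mu$ it is called blind (Hippocratic) randomness. Theorem. Let $\alpha_1,\alpha_2\in\Omega$.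 If $\alpha_1$ is Martin-Löf random with respect to $P_1$, and $\alpha_2$ is blind (Hippocratic) random with oracle $\alpha_1$ with respect to the conditional distribution $P(\cdot\,|\,\alpha_1)$, then the pair $(\alpha_1,\alpha_2)$ is Martin-Löf random with respect to $P$. -/

import Mathlib

open MeasureTheory Filter Topology
open scoped ENNReal

namespace VanLambalgen

/-- The Cantor space of infinite binary sequences. -/
abbrev Cantor : Type := ℕ → Bool

/-- The interval `[a]`: all infinite sequences that extend the finite string `a`. -/
def cyl (a : List Bool) : Set Cantor := {α | ∀ (i : ℕ) (h : i < a.length), α i = a[i]}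

/-- The product `[a] × [b]` of two intervals. -/
def box (p : List Bool × List Bool) : Set (Cantor × Cantor) := cyl p.1 ×ˢ cyl p.2

/-- The prefix of length `n` of an infinite sequence. -/
def initSeg (α : Cantor) (n : ℕ) : List Bool := List.ofFn fun i : Fin n => α i

/-- An infinite binary sequence regarded as an oracle `ℕ → ℕ` with values `0` and `1`. -/
def oracle (α : Cantor) : ℕ →. ℕ := fun n => Part.some (α n).toNat

/-- `p` is enumerable with oracles in `O`: it is the domain of a partial function that is
recursive in `O`. -/
def REPredIn {ι : Type} [Primcodable ι] (O : Set (ℕ →. ℕ)) (p : ι → Prop) : Prop :=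
  RecursiveIn O fun i => Part.assert (p i) fun _ => Part.some ()

/-- The `n`-th member of the family of open sets that is given by a set `W` of pairs
(index, basic set); the family is uniformly effectively open if `W` is enumerable. -/
def openSet {X ι : Type} (B : ι → Set X) (W : ℕ × ι → Prop) (n : ℕ) : Set X :=
  {x | ∃ i, W (n, i) ∧ x ∈ B i}

/-- Martin-Löf tests with oracles in `O` for an arbitrary (not necessarily computable) measure
`μ`, where `B` lists the basic open sets of the space: the sets `openSet B W n` are
effectively open with oracles in `O`, uniformly in `n`, without any access to `μ`. -/
structure IsTest {X ι : Type} [MeasurableSpace X] [Primcodable ι] (B : ι → Set X)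
    (O : Set (ℕ →. ℕ)) (μ : Measure X) (W : ℕ × ι → Prop) : Prop where
  enumerable : REPredIn O W
  measure_le : ∀ n, μ (openSet B W n) ≤ (2⁻¹ : ℝ≥0∞) ^ n

/-- `x` passes all tests with oracles in `O`. For a measure that is computable this
is Martin-Löf randomness with oracles in `O`; for an arbitrary measure this is blind
(Hippocratic) randomness with oracles in `O`. -/
def IsRandom {X ι : Type} [MeasurableSpace X] [Primcodable ι] (B : ι → Set X)
    (O : Set (ℕ →. ℕ)) (μ : Measure X) (x : X) : Prop :=
  ∀ W : ℕ × ι → Prop, IsTest B O μ W → ∃ n, x ∉ openSet B W n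

/-- Martin-Löf randomness of a sequence (without oracle). -/
def MLRandom (μ : Measure Cantor) (α : Cantor) : Prop := IsRandom cyl ∅ μ α

/-- Martin-Löf randomness of a pair of sequences (without oracle). -/
def MLRandomPair (P : Measure (Cantor × Cantor)) (p : Cantor × Cantor) : Prop :=
  IsRandom box ∅ P p

/-- Blind (Hippocratic) randomness of `β` with respect to `μ`, with oracle `α`. -/
def BlindRandom (α : Cantor) (μ : Measure Cantor) (β : Cantor) : Prop :=
  IsRandom cyl {oracle α} μ β

/-- A measure on pairs of sequences is computable if the measures of the products of intervals
are computable reals, uniformly: an algorithm produces, given `a`, `b` and `n`, the numerator of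
a fraction with denominator `2 ^ n` that is `2 ^ (-n)`-close to the measure of `[a] × [b]`. -/
def ComputableMeasure (P : Measure (Cantor × Cantor)) : Prop :=
  ∃ f : (List Bool × List Bool) × ℕ → ℕ, Computable f ∧
    ∀ p n, |(P (box p)).toReal - (f (p, n) : ℝ) / 2 ^ n| ≤ 1 / 2 ^ n

/-- `Q` is the conditional distribution on the second coordinate with the condition that the first
coordinate equals `α`: all prefixes `a` of `α` have positive probability, and
`Q [b] = lim P ([a] × [b]) / P ([a] × Ω)` for every string `b`, as the length of the prefix `a`
of `α` tends to infinity. (The marginal distribution on the first coordinate is `P.fst`.) -/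
structure IsCondMeasure (P : Measure (Cantor × Cantor)) (α : Cantor) (Q : Measure Cantor) :
    Prop where
  pos : ∀ n, 0 < P.fst (cyl (initSeg α n))
  tendsto : ∀ b : List Bool,
    Tendsto (fun n => P (box (initSeg α n, b)) / P.fst (cyl (initSeg α n))) atTop
      (𝓝 (Q (cyl b)))

open Classical in
/-- The conditional distribution `P(· | α)`. It is determined by `IsCondMeasure`, see
`condMeasure_eq`; where the limit distribution does not exist, the value is the zero measure,
and no sequence is random with respect to it, see `not_blindRandom_zero`. -/
noncomputable def condMeasure (P : Measure (Cantor × Cantor)) (α : Cantor) : Measure Cantor :=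
  if h : ∃ Q, IsCondMeasure P α Q then h.choose else 0

theorem cyl_nil : cyl [] = Set.univ := by
  ext α; simp [cyl]

theorem measurableSet_cyl (a : List Bool) : MeasurableSet (cyl a) := by
  have : cyl a = ⋂ (i : ℕ) (h : i < a.length), (fun α : Cantor => α i) ⁻¹' {a[i]} := by
    ext α; simp [cyl]
  rw [this]
  exact MeasurableSet.iInter fun i => MeasurableSet.iInter fun h =>
    measurable_pi_apply i (measurableSet_singleton _)

theorem cyl_inter {a b : List Bool} (hab : a.length ≤ b.length) (h : (cyl a ∩ cyl b).Nonempty) :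
    cyl a ∩ cyl b = cyl b := by
  obtain ⟨α, ha, hb⟩ := h
  refine Set.inter_eq_right.2 fun β hβ i hi => ?_
  rw [hβ i (hi.trans_le hab), ← hb i (hi.trans_le hab), ha i hi]

theorem isPiSystem_cyl : IsPiSystem (Set.range cyl) := by
  rintro _ ⟨a, rfl⟩ _ ⟨b, rfl⟩ h
  rcases le_total a.length b.length with hab | hab
  · exact ⟨b, (cyl_inter hab h).symm⟩
  · rw [Set.inter_comm] at h ⊢
    exact ⟨a, (cyl_inter hab h).symm⟩

theorem mem_cyl_initSeg (α : Cantor) (n : ℕ) : α ∈ cyl (initSeg α n) := by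
  intro i h; simp [initSeg]

theorem generateFrom_cyl :
    (inferInstance : MeasurableSpace Cantor) = MeasurableSpace.generateFrom (Set.range cyl) := by
  refine le_antisymm (iSup_le fun i => ?_) ?_
  · rintro _ ⟨s, -, rfl⟩
    have : (fun α : Cantor => α i) ⁻¹' s =
        ⋃ (a : List Bool) (_ : ∃ α : Cantor, a = initSeg α (i + 1) ∧ α i ∈ s), cyl a := by
      ext β
      simp only [Set.mem_preimage, Set.mem_iUnion, exists_prop]
      constructor
      · exact fun h => ⟨_, ⟨β, rfl, h⟩, mem_cyl_initSeg β _⟩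
      · rintro ⟨_, ⟨α, rfl, h⟩, hβ⟩
        have := hβ i (by simp [initSeg])
        have e : (initSeg α (i + 1))[i]'(by simp [initSeg]) = α i :=
          List.getElem_ofFn _
        rw [this, e]
        exact h
    rw [this]
    exact MeasurableSet.biUnion (Set.to_countable _) fun a _ =>
      MeasurableSpace.measurableSet_generateFrom ⟨a, rfl⟩
  · refine MeasurableSpace.generateFrom_le ?_
    rintro _ ⟨a, rfl⟩
    exact measurableSet_cyl a

theorem IsCondMeasure.isProbabilityMeasure {P : Measure (Cantor × Cantor)}
    [IsProbabilityMeasure P] {α : Cantor} {Q : Measure Cantor} (h : IsCondMeasure P α Q) :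
    IsProbabilityMeasure Q := by
  refine ⟨?_⟩
  have h1 := h.tendsto []
  rw [cyl_nil] at h1
  refine tendsto_nhds_unique h1 (tendsto_const_nhds.congr fun n => ?_)
  have : P (box (initSeg α n, [])) = P.fst (cyl (initSeg α n)) := by
    rw [Measure.fst_apply (measurableSet_cyl _), box, cyl_nil, Set.prod_univ]
  rw [this, ENNReal.div_self (h.pos n).ne' (measure_ne_top _ _)]

theorem IsCondMeasure.unique {P : Measure (Cantor × Cantor)} [IsProbabilityMeasure P]
    {α : Cantor} {Q Q' : Measure Cantor} (h : IsCondMeasure P α Q) (h' : IsCondMeasure P α Q') :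
    Q = Q' := by
  have := h.isProbabilityMeasure
  have := h'.isProbabilityMeasure
  refine ext_of_generate_finite _ generateFrom_cyl isPiSystem_cyl ?_ (by simp)
  rintro _ ⟨b, rfl⟩
  exact tendsto_nhds_unique (h.tendsto b) (h'.tendsto b)

/-- `condMeasure P α` is the conditional distribution whenever there is one. -/
theorem condMeasure_eq {P : Measure (Cantor × Cantor)} [IsProbabilityMeasure P]
    {α : Cantor} {Q : Measure Cantor} (h : IsCondMeasure P α Q) : condMeasure P α = Q := by
  have hex : ∃ Q, IsCondMeasure P α Q := ⟨Q, h⟩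
  rw [condMeasure, dif_pos hex]
  exact hex.choose_spec.unique h

/-- No sequence is random with respect to the zero measure. -/
theorem not_blindRandom_zero (α β : Cantor) : ¬ BlindRandom α 0 β := by
  intro h
  have hre : REPredIn {oracle α} fun _ : ℕ × List Bool => True :=
    RecursiveIn.of_eq (ComputableIn.const ()).recursiveIn fun _ =>
      (Part.assert_pos (f := fun _ => Part.some ()) trivial).symm
  obtain ⟨n, hn⟩ := h (fun _ => True) ⟨hre, by simp⟩
  exact hn ⟨[], trivial, by simp [cyl_nil]⟩

end VanLambalgen

/-!
Let `U n` be a test for `P`, and let `P (U | a)` be the conditional probability of `U` given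
`[a] × Ω`. For fixed `m`, the intervals `[a]` with `P (U (2 * m) | a) > 2 ^ (-m)` cover a set of
`P.fst`-measure at most `2 ^ m * P (U (2 * m)) ≤ 2 ^ (-m)`, because the prefix-minimal ones among
them are disjoint. Such `a` can be enumerated, since `P` is computable, so their unions over `m > N`
form a test for `P.fst`. Hence for some `N` no prefix `a` of `α₁` satisfies
`P (U (2 * m) | a) > 2 ^ (-m)` with `m > N`. In the limit along the prefixes of `α₁`, the section of
`U (2 * m)` at `α₁` has conditional measure at most `2 ^ (-m)`. These sections are effectively open
with oracle `α₁`, without access to the conditional measure, so they form a blind test, and `α₂`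
lies outside one of them.
-/

namespace VanLambalgen

section Recursion

variable {ι κ σ : Type} [Primcodable ι] [Primcodable κ] [Primcodable σ] {O : Set (ℕ →. ℕ)}

theorem computableIn_comp {f : κ → σ} {g : ι → κ} (hf : ComputableIn O f)
    (hg : ComputableIn O g) : ComputableIn O fun x => f (g x) := by
  refine (Nat.RecursiveIn.comp hf hg).of_eq fun n => ?_
  cases h : (Encodable.decode n : Option ι) <;> simp

theorem computableIn_pair {f : ι → κ} {g : ι → σ} (hf : ComputableIn O f)
    (hg : ComputableIn O g) : ComputableIn O fun x => (f x, g x) := by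
  refine (Nat.RecursiveIn.pair hf hg).of_eq fun n => ?_
  cases h : (Encodable.decode n : Option ι) <;> simp [Seq.seq]

theorem computableIn_natRec (z : σ) {h : ℕ × σ → σ} (hh : ComputableIn O h) :
    ComputableIn O fun n : ℕ => (n.rec z fun k s => h (k, s) : σ) := by
  have hz : Nat.RecursiveIn O fun _ => Part.some (Encodable.encode z) :=
    RecursiveIn.iff_nat.1 (ComputableIn.const (α := ℕ) (Encodable.encode z))
  have hstep : Nat.RecursiveIn O fun n => Part.bind (Encodable.decode (α := ℕ × σ) n.unpair.2)
      fun q => Part.some (Encodable.encode (h q)) := by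
    refine (Nat.RecursiveIn.comp hh Nat.RecursiveIn.right).of_eq fun n => ?_
    simp
  have hinput : Nat.RecursiveIn O fun n => Part.some (Nat.pair 0 n) :=
    RecursiveIn.iff_nat.1 (Primrec₂.natPair.comp (Primrec.const 0) Primrec.id).computableIn
  refine (Nat.RecursiveIn.comp (Nat.RecursiveIn.prec hz hstep) hinput).of_eq fun n => ?_
  simp only [Part.bind_eq_bind, Part.bind_some, Nat.unpair_pair, Encodable.decode_nat,
    Part.coe_some, Part.map_some]
  induction n with
  | zero => rfl
  | succ n ih =>
    dsimp only
    rw [ih]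
    simp

theorem initSeg_succ (α : Cantor) (n : ℕ) : initSeg α (n + 1) = initSeg α n ++ [α n] := by
  simp only [initSeg, List.ofFn_succ_last, Fin.val_castSucc, Fin.val_last]

theorem computableIn_initSeg (α : Cantor) : ComputableIn {oracle α} (initSeg α) := by
  have hα : ComputableIn {oracle α} α := by
    have hdecide : Computable fun n : ℕ => decide (n = 1) :=
      (Primrec.eq.decide.comp Primrec.id (Primrec.const 1)).to_comp
    have hnat : ComputableIn {oracle α} fun n => (α n).toNat :=
      RecursiveIn.oracle (oracle α) rfl
    refine (computableIn_comp hdecide.computableIn hnat).of_eq fun n => ?_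
    cases h : α n <;> simp [h]
  refine (computableIn_natRec (h := fun q => q.2 ++ [α q.1]) [] ?_).of_eq fun n => ?_
  · exact computableIn_comp (f := fun z : List Bool × Bool => z.1 ++ [z.2])
      Primrec.list_concat.computableIn
      (computableIn_pair ComputableIn.snd (computableIn_comp hα ComputableIn.fst))
  · congr 1
    induction n with
    | zero => rfl
    | succ n ih => rw [initSeg_succ, ← ih]

theorem computable_two_pow : Computable fun n : ℕ => 2 ^ n :=
  ((Primrec₂.unpaired'.1 Nat.Primrec.pow).comp (Primrec.const 2) Primrec.id).to_comp

theorem computable_sum_range {g : ι × ℕ → ℕ} (hg : Computable g)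
    {n : ι → ℕ} (hn : Computable n) : Computable fun x => ∑ k ∈ Finset.range (n x), g (x, k) := by
  refine (Computable.nat_rec (h := fun x q => q.2 + g (x, q.1)) hn (Computable.const 0) ?_).of_eq
    fun x => ?_
  · exact (Primrec.nat_add.to_comp.comp (Computable.snd.comp Computable.snd)
      (hg.comp (Computable.fst.pair (Computable.fst.comp Computable.snd)))).to₂
  · induction n x with
    | zero => rfl
    | succ k ih => rw [Finset.sum_range_succ, ← ih]

theorem computable_extend_encode {g : ι × κ → ℕ} (hg : Computable g) {n : ι → ℕ}
    (hn : Computable n) :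
    Computable fun x => Function.extend Encodable.encode (fun y => g (x, y)) 0 (n x) := by
  refine (Computable.option_getD (Computable.option_map (Primrec.decode₂.to_comp.comp hn) hg.to₂)
    (Computable.const 0)).of_eq fun x => ?_
  by_cases hk : ∃ y : κ, Encodable.encode y = n x
  · obtain ⟨y, hy⟩ := hk
    simp [← hy, Encodable.encode_injective.extend_apply]
  · rw [Function.extend_apply' _ _ _ hk]
    have hnone : Encodable.decode₂ κ (n x) = none :=
      not_ne_iff.1 (mt Encodable.decode₂_ne_none_iff.1 hk)
    simp [hnone]

end Recursion

section Enumerable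

variable {ι κ : Type} [Primcodable ι] [Primcodable κ] {O : Set (ℕ →. ℕ)}

theorem REPredIn.of_computablePred {p : ι → Prop} (hp : ComputablePred p) : REPredIn ∅ p :=
  recursiveIn_empty_iff.2 hp.to_re

theorem REPredIn.comp {p : κ → Prop} (hp : REPredIn O p) {g : ι → κ} (hg : ComputableIn O g) :
    REPredIn O fun x => p (g x) := by
  refine (Nat.RecursiveIn.comp hp hg).of_eq fun n => ?_
  cases h : (Encodable.decode n : Option ι) <;> simp

theorem REPredIn.and {p q : ι → Prop} (hp : REPredIn ∅ p) (hq : REPredIn ∅ q) :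
    REPredIn ∅ fun x => p x ∧ q x := by
  refine recursiveIn_empty_iff.2 (((recursiveIn_empty_iff.1 hp).bind
    ((recursiveIn_empty_iff.1 hq).comp Computable.fst).to₂).of_eq fun x => ?_)
  by_cases hpx : p x <;> by_cases hqx : q x <;> simp [hpx, hqx, Part.assert_pos, Part.assert_neg]

theorem REPredIn.of_exists {p : ι → Prop} {F : ι × ℕ → Bool} (hF : ComputableIn O F)
    (h : ∀ x, p x ↔ ∃ t, F (x, t)) : REPredIn O p := by
  have hnot : ComputableIn O fun z => (!F z).toNat :=
    computableIn_comp (f := fun b : Bool => (!b).toNat) (Primrec.dom_finite _).computableIn hF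
  have hzero : Nat.RecursiveIn O fun _ => Part.some 0 := Nat.RecursiveIn.zero
  have hsearch : ∀ x, ((Nat.rfind fun t => Part.some (F (x, t))).bind fun _ => Part.some 0) =
      Part.map Encodable.encode (Part.assert (p x) fun _ => Part.some ()) := by
    intro x
    by_cases hx : p x
    · obtain ⟨t, ht⟩ := (h x).1 hx
      obtain ⟨m, hm, -⟩ := Nat.rfind_min' (p := fun t => F (x, t)) ht
      rw [Part.assert_pos hx]
      exact (congrArg (fun r : Part ℕ => r.bind fun _ => Part.some 0)
        (Part.eq_some_iff.2 hm)).trans (by simp)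
    · rw [Part.assert_neg hx, Part.map_none, Part.eq_none_iff]
      rintro v hv
      obtain ⟨m, hm, -⟩ := Part.mem_bind_iff.1 hv
      exact hx ((h x).2 ⟨m, (Part.mem_some_iff.1 (Nat.rfind_spec hm)).symm⟩)
  refine (Nat.RecursiveIn.comp hzero (Nat.RecursiveIn.rfind hnot)).of_eq fun n => ?_
  cases hn : (Encodable.decode n : Option ι) with
  | none => simp [hn, Nat.rfind_zero_none (fun _ => Part.none) rfl]
  | some x => simpa [hn] using hsearch x

theorem REPredIn.exists_stage {p : ι → Prop} (hp : REPredIn ∅ p) :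
    ∃ T : ι × ℕ → Bool, Computable T ∧ (∀ x, p x ↔ ∃ s, T (x, s)) ∧
      ∀ x, Monotone fun s => T (x, s) := by
  obtain ⟨c, hc⟩ := Nat.Partrec.Code.exists_code.1 (recursiveIn_empty_iff.1 hp)
  refine ⟨fun z => (Nat.Partrec.Code.evaln z.2 c (Encodable.encode z.1)).isSome, ?_, ?_, ?_⟩
  · exact (Primrec.option_isSome.comp (Nat.Partrec.Code.primrec_evaln.comp
      ((Primrec.snd.pair (Primrec.const c)).pair (Primrec.encode.comp Primrec.fst)))).to_comp
  · intro x
    have heval : p x ↔ ∃ v, v ∈ c.eval (Encodable.encode x) := by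
      rw [hc]
      simp
    simp only [heval, Nat.Partrec.Code.evaln_complete, Option.isSome_iff_exists, Option.mem_def]
    exact exists_comm
  · intro x s t hst
    simp only [Bool.le_iff_imp, Option.isSome_iff_exists]
    exact fun ⟨v, hv⟩ => ⟨v, Nat.Partrec.Code.evaln_mono hst hv⟩

theorem REPredIn.exists_comp {p : κ → Prop} (hp : REPredIn ∅ p) {g : ι × ℕ → κ}
    (hg : ComputableIn O g) : REPredIn O fun x => ∃ t, p (g (x, t)) := by
  obtain ⟨T, hT, hpT, -⟩ := hp.exists_stage
  refine REPredIn.of_exists (F := fun z => T (g (z.1, z.2.unpair.1), z.2.unpair.2)) ?_ fun x => ?_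
  · have hunpair : ComputableIn O fun z : ι × ℕ => z.2.unpair :=
      computableIn_comp ComputableIn.unpair ComputableIn.snd
    exact computableIn_comp hT.computableIn (computableIn_pair
      (computableIn_comp hg (computableIn_pair ComputableIn.fst
        (computableIn_comp ComputableIn.fst hunpair)))
      (computableIn_comp ComputableIn.snd hunpair))
  · simp only [hpT]
    constructor
    · rintro ⟨t, s, h⟩
      exact ⟨Nat.pair t s, by simpa using h⟩
    · rintro ⟨n, h⟩
      exact ⟨_, _, h⟩

end Enumerable

section Semicomputable

variable {ι κ : Type} [Primcodable ι] [Primcodable κ]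

/-- `φ` is lower semicomputable: uniformly in `x`, the value `φ x` is the limit of a computable
nondecreasing sequence of dyadic rationals. The `s`-th approximation has denominator `2 ^ s`. -/
def LowerSemicomputable (φ : ι → ℝ≥0∞) : Prop :=
  ∃ g : ι × ℕ → ℕ, Computable g ∧ (∀ x, Monotone fun s => (g (x, s) : ℝ≥0∞) / 2 ^ s) ∧
    ∀ x, φ x = ⨆ s, (g (x, s) : ℝ≥0∞) / 2 ^ s

/-- `φ` is upper semicomputable: uniformly in `x`, the value `φ x` is the infimum of a computable
sequence of dyadic rationals. The `s`-th approximation has denominator `2 ^ s`. -/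
def UpperSemicomputable (φ : ι → ℝ≥0∞) : Prop :=
  ∃ g : ι × ℕ → ℕ, Computable g ∧ ∀ x, φ x = ⨅ s, (g (x, s) : ℝ≥0∞) / 2 ^ s

theorem natCast_div_two_pow_lt_iff {a b s t : ℕ} :
    (a : ℝ≥0∞) / 2 ^ s < b / 2 ^ t ↔ a * 2 ^ t < b * 2 ^ s := by
  have hcoe : ∀ c n : ℕ, (c : ℝ≥0∞) / 2 ^ n = ((c / 2 ^ n : NNReal) : ℝ≥0∞) := by
    intro c n
    rw [ENNReal.coe_div (by positivity)]
    push_cast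
    rfl
  rw [hcoe, hcoe, ENNReal.coe_lt_coe, div_lt_div_iff₀ (by positivity) (by positivity)]
  exact_mod_cast Iff.rfl

theorem two_mul_natCast_div_two_pow_succ (a n : ℕ) :
    ((2 * a : ℕ) : ℝ≥0∞) / 2 ^ (n + 1) = a / 2 ^ n := by
  rw [pow_succ', Nat.cast_mul, Nat.cast_ofNat,
    ENNReal.mul_div_mul_left _ _ two_ne_zero ENNReal.ofNat_ne_top]

theorem monotone_natCast_div_two_pow {g : ℕ → ℕ} (hg : ∀ n, 2 * g n ≤ g (n + 1)) :
    Monotone fun n => (g n : ℝ≥0∞) / 2 ^ n :=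
  monotone_nat_of_le_succ fun n => by
    rw [← two_mul_natCast_div_two_pow_succ (g n)]
    gcongr
    exact hg n

theorem antitone_natCast_div_two_pow {g : ℕ → ℕ} (hg : ∀ n, g (n + 1) ≤ 2 * g n) :
    Antitone fun n => (g n : ℝ≥0∞) / 2 ^ n :=
  antitone_nat_of_succ_le fun n => by
    rw [← two_mul_natCast_div_two_pow_succ (g n)]
    gcongr
    exact hg n

theorem tendsto_natCast_div_two_pow {x : ℝ≥0∞} (hx : x ≠ ∞) {g : ℕ → ℕ} {C : ℝ}
    (hg : ∀ n, |x.toReal - (g n : ℝ) / 2 ^ n| ≤ C / 2 ^ n) :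
    Tendsto (fun n => (g n : ℝ≥0∞) / 2 ^ n) atTop (𝓝 x) := by
  rw [← ENNReal.tendsto_toReal_iff (fun n => ENNReal.div_ne_top (by simp) (by simp)) hx]
  have herror : Tendsto (fun n : ℕ => C / 2 ^ n) atTop (𝓝 0) :=
    tendsto_const_nhds.div_atTop (tendsto_pow_atTop_atTop_of_one_lt one_lt_two)
  refine tendsto_iff_dist_tendsto_zero.2 (squeeze_zero (fun _ => dist_nonneg) (fun n => ?_) herror)
  simpa [dist_comm, Real.dist_eq, abs_sub_comm] using hg n

theorem LowerSemicomputable.comp {φ : κ → ℝ≥0∞} (hφ : LowerSemicomputable φ) {f : ι → κ}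
    (hf : Computable f) : LowerSemicomputable fun x => φ (f x) := by
  obtain ⟨g, hg, hmono, hsup⟩ := hφ
  exact ⟨fun z => g (f z.1, z.2), hg.comp ((hf.comp Computable.fst).pair Computable.snd),
    fun x => hmono (f x), fun x => hsup (f x)⟩

theorem UpperSemicomputable.comp {φ : κ → ℝ≥0∞} (hφ : UpperSemicomputable φ) {f : ι → κ}
    (hf : Computable f) : UpperSemicomputable fun x => φ (f x) := by
  obtain ⟨g, hg, hinf⟩ := hφ
  exact ⟨fun z => g (f z.1, z.2), hg.comp ((hf.comp Computable.fst).pair Computable.snd),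
    fun x => hinf (f x)⟩

theorem UpperSemicomputable.rePredIn_lt {φ ψ : ι → ℝ≥0∞} (hφ : UpperSemicomputable φ)
    (hψ : LowerSemicomputable ψ) : REPredIn ∅ fun x => φ x < ψ x := by
  obtain ⟨f, hf, hinf⟩ := hφ
  obtain ⟨g, hg, -, hsup⟩ := hψ
  have hlt : ComputablePred fun z : (ι × ℕ) × ℕ =>
      f (z.1.1, z.2) * 2 ^ z.1.2 < g z.1 * 2 ^ z.2 :=
    ⟨inferInstance, Primrec.nat_lt.decide.to_comp.comp
      (Primrec.nat_mul.to_comp.comp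
        (hf.comp ((Computable.fst.comp Computable.fst).pair Computable.snd))
        (computable_two_pow.comp (Computable.snd.comp Computable.fst)))
      (Primrec.nat_mul.to_comp.comp (hg.comp Computable.fst)
        (computable_two_pow.comp Computable.snd))⟩
  simpa only [hinf, hsup, iInf_lt_iff, lt_iSup_iff, natCast_div_two_pow_lt_iff, id] using
    ((REPredIn.of_computablePred hlt).exists_comp ComputableIn.id).exists_comp
      (ComputableIn.id (O := ∅))

theorem LowerSemicomputable.two_pow_mul {φ : ι → ℝ≥0∞} (hφ : LowerSemicomputable φ) {n : ι → ℕ}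
    (hn : Computable n) : LowerSemicomputable fun x => 2 ^ n x * φ x := by
  obtain ⟨g, hg, hmono, hsup⟩ := hφ
  have hscale : ∀ x s, ((2 ^ n x * g (x, s) : ℕ) : ℝ≥0∞) / 2 ^ s =
      2 ^ n x * ((g (x, s) : ℝ≥0∞) / 2 ^ s) := fun x s => by
    push_cast
    rw [mul_div_assoc]
  refine ⟨fun z => 2 ^ n z.1 * g z, ?_, fun x => ?_, fun x => ?_⟩
  · exact Primrec.nat_mul.to_comp.comp (computable_two_pow.comp (hn.comp Computable.fst)) hg
  · simp only [hscale]
    exact (hmono x).const_mul' _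
  · simp only [hscale]
    rw [hsup, ENNReal.mul_iSup]

theorem LowerSemicomputable.indicator {φ : ι → ℝ≥0∞} (hφ : LowerSemicomputable φ) {p : ι → Prop}
    (hp : REPredIn ∅ p) : LowerSemicomputable ({x | p x}.indicator φ) := by
  obtain ⟨g, hg, hmono, hsup⟩ := hφ
  obtain ⟨T, hT, hpT, hTmono⟩ := hp.exists_stage
  refine ⟨fun z => bif T z then g z else 0, Computable.cond hT hg (Computable.const 0),
    fun x s t hst => ?_, fun x => ?_⟩
  · have hle := hTmono x hst
    have hgle := hmono x hst
    cases hs : T (x, s) with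
    | false => simp [hs]
    | true =>
      have ht : T (x, t) := hle hs
      simpa [hs, ht] using hgle
  · by_cases hx : p x
    · rw [Set.indicator_of_mem (show x ∈ {x | p x} from hx), hsup]
      obtain ⟨s, hs⟩ := (hpT x).1 hx
      refine le_antisymm (iSup_le fun t => ?_) (iSup_mono fun t => ?_)
      · refine le_iSup_of_le (max s t) ?_
        have hmax : T (x, max s t) := hTmono x (le_max_left s t) hs
        simpa [hmax] using hmono x (le_max_right s t)
      · cases hcase : T (x, t) <;> simp [hcase]
    · rw [Set.indicator_of_notMem (show x ∉ {x | p x} from hx)]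
      have hT0 : ∀ s, T (x, s) = false := fun s =>
        Bool.eq_false_iff.2 fun hs => hx ((hpT x).2 ⟨s, hs⟩)
      simp [hT0]

theorem LowerSemicomputable.tsum_nat {φ : ι × ℕ → ℝ≥0∞} (hφ : LowerSemicomputable φ) :
    LowerSemicomputable fun x => ∑' k, φ (x, k) := by
  obtain ⟨g, hg, hmono, hsup⟩ := hφ
  have hcast : ∀ x t, ((∑ k ∈ Finset.range t, g ((x, k), t) : ℕ) : ℝ≥0∞) / 2 ^ t =
      ∑ k ∈ Finset.range t, (g ((x, k), t) : ℝ≥0∞) / 2 ^ t := fun x t => by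
    simp only [Nat.cast_sum, div_eq_mul_inv, Finset.sum_mul]
  refine ⟨fun z => ∑ k ∈ Finset.range z.2, g ((z.1, k), z.2), ?_, fun x s t hst => ?_, fun x => ?_⟩
  · exact computable_sum_range (g := fun w : (ι × ℕ) × ℕ => g ((w.1.1, w.2), w.1.2))
      (hg.comp (((Computable.fst.comp Computable.fst).pair Computable.snd).pair
        (Computable.snd.comp Computable.fst))) Computable.snd
  · simp only [hcast]
    exact (Finset.sum_le_sum fun k _ => hmono (x, k) hst).trans
      (Finset.sum_le_sum_of_subset (Finset.range_mono hst))
  · simp only [hcast, ENNReal.tsum_eq_iSup_nat, hsup,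
      ENNReal.finsetSum_iSup_of_monotone fun k => hmono (x, k)]
    refine le_antisymm (iSup₂_le fun n s => le_iSup_of_le (max n s) ?_)
      (iSup_le fun t => le_iSup₂_of_le t t le_rfl)
    exact (Finset.sum_le_sum fun k _ => hmono (x, k) (le_max_right n s)).trans
      (Finset.sum_le_sum_of_subset (Finset.range_mono (le_max_left n s)))

theorem LowerSemicomputable.tsum {φ : ι × κ → ℝ≥0∞} (hφ : LowerSemicomputable φ) :
    LowerSemicomputable fun x => ∑' y, φ (x, y) := by
  obtain ⟨g, hg, hmono, hsup⟩ := hφ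
  let φ' : ι × ℕ → ℝ≥0∞ := fun z => Function.extend Encodable.encode (fun y => φ (z.1, y)) 0 z.2
  have hφ' : LowerSemicomputable φ' := by
    refine ⟨fun z => Function.extend Encodable.encode (fun y => g ((z.1.1, y), z.2)) 0 z.1.2,
      ?_, ?_, ?_⟩
    · exact computable_extend_encode (g := fun w : ((ι × ℕ) × ℕ) × κ => g ((w.1.1.1, w.2), w.1.2))
        (hg.comp (((Computable.fst.comp (Computable.fst.comp Computable.fst)).pair
          Computable.snd).pair (Computable.snd.comp Computable.fst)))
        (Computable.snd.comp Computable.fst)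
    · rintro ⟨x, k⟩
      by_cases hk : ∃ y : κ, Encodable.encode y = k
      · obtain ⟨y, rfl⟩ := hk
        simpa only [Encodable.encode_injective.extend_apply] using hmono (x, y)
      · simp [Function.extend_apply' _ _ _ hk, monotone_const]
    · rintro ⟨x, k⟩
      by_cases hk : ∃ y : κ, Encodable.encode y = k
      · obtain ⟨y, rfl⟩ := hk
        simpa only [φ', Encodable.encode_injective.extend_apply] using hsup (x, y)
      · simp [φ', Function.extend_apply' _ _ _ hk]
  simpa only [φ', tsum_extend_zero Encodable.encode_injective] using hφ'.tsum_nat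

theorem abs_sub_div_two_pow_le_iff {r a C : ℝ} {n : ℕ} :
    |r - a / 2 ^ n| ≤ C / 2 ^ n ↔ |r * 2 ^ n - a| ≤ C := by
  have hpos : (0 : ℝ) < 2 ^ n := by positivity
  rw [le_div_iff₀ hpos, ← abs_of_pos hpos, ← abs_mul, abs_of_pos hpos, sub_mul,
    div_mul_cancel₀ _ hpos.ne']

/-- Consecutive approximations differ by at most `1 / 2 ^ n + 1 / 2 ^ (n + 1) = 3 / 2 ^ (n + 1)`, so
lowering (raising) all numerators by `3` makes the sequence nondecreasing (nonincreasing). -/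
theorem two_mul_le_add_three_of_approx {r : ℝ} {f : ℕ → ℕ}
    (hf : ∀ n, |r - (f n : ℝ) / 2 ^ n| ≤ 1 / 2 ^ n) (n : ℕ) :
    2 * f n ≤ f (n + 1) + 3 ∧ f (n + 1) ≤ 2 * f n + 3 := by
  have hn := abs_le.1 (abs_sub_div_two_pow_le_iff.1 (hf n))
  have hsucc := abs_le.1 (abs_sub_div_two_pow_le_iff.1 (hf (n + 1)))
  rw [pow_succ] at hsucc
  constructor
  · have : (2 * f n : ℝ) ≤ f (n + 1) + 3 := by linarith
    exact_mod_cast this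
  · have : (f (n + 1) : ℝ) ≤ 2 * f n + 3 := by linarith
    exact_mod_cast this

theorem ComputableMeasure.lowerSemicomputable {P : Measure (Cantor × Cantor)} [IsFiniteMeasure P]
    (hP : ComputableMeasure P) : LowerSemicomputable fun p => P (box p) := by
  obtain ⟨f, hf, happrox⟩ := hP
  have hmono : ∀ p, Monotone fun n => ((f (p, n) - 3 : ℕ) : ℝ≥0∞) / 2 ^ n := fun p =>
    monotone_natCast_div_two_pow fun n => by
      have := (two_mul_le_add_three_of_approx (happrox p) n).1
      omega
  refine ⟨fun z => f z - 3, Primrec.nat_sub.to_comp.comp hf (Computable.const 3), hmono,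
    fun p => (iSup_eq_of_tendsto (hmono p) (tendsto_natCast_div_two_pow (C := 4)
      (measure_ne_top P _) fun n => ?_)).symm⟩
  have hclose := abs_le.1 (abs_sub_div_two_pow_le_iff.1 (happrox p n))
  have hle : f (p, n) ≤ (f (p, n) - 3 : ℕ) + 3 := by omega
  have hge : f (p, n) - 3 ≤ f (p, n) := by omega
  refine abs_sub_div_two_pow_le_iff.2 (abs_le.2 ?_)
  rify at hle hge
  constructor <;> linarith

theorem ComputableMeasure.upperSemicomputable {P : Measure (Cantor × Cantor)} [IsFiniteMeasure P]
    (hP : ComputableMeasure P) : UpperSemicomputable fun p => P (box p) := by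
  obtain ⟨f, hf, happrox⟩ := hP
  have hanti : ∀ p, Antitone fun n => ((f (p, n) + 3 : ℕ) : ℝ≥0∞) / 2 ^ n := fun p =>
    antitone_natCast_div_two_pow fun n => by
      have := (two_mul_le_add_three_of_approx (happrox p) n).2
      omega
  refine ⟨fun z => f z + 3, Primrec.nat_add.to_comp.comp hf (Computable.const 3),
    fun p => (iInf_eq_of_tendsto (hanti p) (tendsto_natCast_div_two_pow (C := 4)
      (measure_ne_top P _) fun n => ?_)).symm⟩
  have hclose := abs_le.1 (abs_sub_div_two_pow_le_iff.1 (happrox p n))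
  refine abs_sub_div_two_pow_le_iff.2 (abs_le.2 ?_)
  push_cast
  constructor <;> linarith

end Semicomputable

section Strings

theorem length_initSeg (α : Cantor) (n : ℕ) : (initSeg α n).length = n := List.length_ofFn

theorem prefix_initSeg_iff {α : Cantor} {n : ℕ} {a : List Bool} :
    a <+: initSeg α n ↔ a.length ≤ n ∧ α ∈ cyl a := by
  simp [List.prefix_iff_getElem, initSeg, cyl, eq_comm]

theorem initSeg_eq_iff {α : Cantor} {n : ℕ} {a : List Bool} :
    initSeg α n = a ↔ a.length = n ∧ α ∈ cyl a := by
  constructor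
  · rintro rfl
    exact ⟨length_initSeg α n, mem_cyl_initSeg α n⟩
  · rintro ⟨rfl, hα⟩
    exact ((prefix_initSeg_iff.2 ⟨le_rfl, hα⟩).eq_of_length (length_initSeg α _).symm).symm

/-- The pair of the prefixes of length `n` of two sequences. -/
def initSegPair (n : ℕ) (x : Cantor × Cantor) : List Bool × List Bool :=
  (initSeg x.1 n, initSeg x.2 n)

/-- The pairs of strings that extend some pair in `D` componentwise. -/
def extensions (D : Set (List Bool × List Bool)) : Set (List Bool × List Bool) :=
  {p | ∃ q ∈ D, q.1 <+: p.1 ∧ q.2 <+: p.2}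

theorem initSegPair_mem_extensions_iff {n : ℕ} {x : Cantor × Cantor}
    {D : Set (List Bool × List Bool)} :
    initSegPair n x ∈ extensions D ↔ ∃ q ∈ D, (q.1.length ≤ n ∧ q.2.length ≤ n) ∧ x ∈ box q := by
  simp only [extensions, initSegPair, Set.mem_ofPred_eq, prefix_initSeg_iff, box, Set.mem_prod]
  exact exists_congr fun q => and_congr_right fun _ => and_and_and_comm

theorem monotone_preimage_extensions (D : Set (List Bool × List Bool)) :
    Monotone fun n => initSegPair n ⁻¹' extensions D := by
  intro m n hmn x hx
  obtain ⟨q, hq, ⟨h₁, h₂⟩, hxq⟩ := initSegPair_mem_extensions_iff.1 hx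
  exact initSegPair_mem_extensions_iff.2 ⟨q, hq, ⟨h₁.trans hmn, h₂.trans hmn⟩, hxq⟩

theorem iUnion_preimage_extensions (D : Set (List Bool × List Bool)) :
    ⋃ n, initSegPair n ⁻¹' extensions D = ⋃ q ∈ D, box q := by
  ext x
  simp only [Set.mem_iUnion, Set.mem_preimage, initSegPair_mem_extensions_iff, exists_prop]
  constructor
  · rintro ⟨n, q, hq, -, hxq⟩
    exact ⟨q, hq, hxq⟩
  · rintro ⟨q, hq, hxq⟩
    exact ⟨max q.1.length q.2.length, q, hq, ⟨le_max_left _ _, le_max_right _ _⟩, hxq⟩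

theorem openSet_eq_biUnion {X ι : Type} (B : ι → Set X) (W : ℕ × ι → Prop) (n : ℕ) :
    openSet B W n = ⋃ i ∈ {i | W (n, i)}, B i := by
  ext x
  simp [openSet]

theorem box_nil_right (a : List Bool) : box (a, []) = Prod.fst ⁻¹' cyl a := by
  rw [box, cyl_nil, Set.prod_univ]

theorem preimage_initSegPair_singleton (n : ℕ) (p : List Bool × List Bool) :
    initSegPair n ⁻¹' {p} = {_x | p.1.length = n ∧ p.2.length = n} ∩ box p := by
  ext x
  simp only [initSegPair, Set.mem_preimage, Set.mem_singleton_iff, Prod.ext_iff, initSeg_eq_iff,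
    box, Set.mem_prod, Set.mem_inter_iff, Set.mem_ofPred_eq]
  exact and_and_and_comm

theorem measurableSet_box (p : List Bool × List Bool) : MeasurableSet (box p) :=
  (measurableSet_cyl p.1).prod (measurableSet_cyl p.2)

theorem measure_preimage_initSegPair (P : Measure (Cantor × Cantor)) (n : ℕ)
    (E : Set (List Bool × List Bool)) :
    P (initSegPair n ⁻¹' E) =
      ∑' p, {p | p ∈ E ∧ p.1.length = n ∧ p.2.length = n}.indicator (fun p => P (box p)) p := by
  classical
  have hmeas : ∀ p ∈ E, MeasurableSet (initSegPair n ⁻¹' {p}) := fun p _ => by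
    rw [preimage_initSegPair_singleton]
    exact (MeasurableSet.const _).inter (measurableSet_box p)
  rw [← tsum_measure_preimage_singleton (Set.to_countable E) hmeas,
    tsum_subtype E fun p => P (initSegPair n ⁻¹' {p})]
  refine tsum_congr fun p => ?_
  rw [Set.indicator_apply, Set.indicator_apply, preimage_initSegPair_singleton]
  by_cases hE : p ∈ E <;> by_cases hn : p.1.length = n ∧ p.2.length = n <;> simp [hE, hn]

theorem measure_biUnion_box_inter (P : Measure (Cantor × Cantor))
    (D D' : Set (List Bool × List Bool)) :
    P ((⋃ q ∈ D, box q) ∩ ⋃ q ∈ D', box q) =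
      ⨆ n, P (initSegPair n ⁻¹' (extensions D ∩ extensions D')) := by
  rw [← iUnion_preimage_extensions, ← iUnion_preimage_extensions,
    ← Set.iUnion_inter_of_monotone (monotone_preimage_extensions D)
      (monotone_preimage_extensions D'), ← Monotone.measure_iUnion]
  · simp only [Set.preimage_inter]
  · exact (monotone_preimage_extensions D).inter (monotone_preimage_extensions D')

end Strings

section EffectiveStrings

variable {ι : Type} [Primcodable ι]

theorem REPredIn.mem_extensions {W : ι × List Bool × List Bool → Prop} (hW : REPredIn ∅ W) :
    REPredIn ∅ fun x : ι × List Bool × List Bool => x.2 ∈ extensions {q | W (x.1, q)} := by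
  have htake : Computable fun z : (ι × List Bool × List Bool) × ℕ =>
      (z.1.1, z.1.2.1.take z.2.unpair.1, z.1.2.2.take z.2.unpair.2) := by
    have hindex : Primrec fun z : (ι × List Bool × List Bool) × ℕ => z.2.unpair :=
      Primrec.unpair.comp Primrec.snd
    have hstring : Primrec fun z : (ι × List Bool × List Bool) × ℕ => z.1.2 :=
      Primrec.snd.comp Primrec.fst
    exact ((Primrec.fst.comp Primrec.fst).pair
      ((Primrec.list_take.comp (Primrec.fst.comp hindex) (Primrec.fst.comp hstring)).pair
        (Primrec.list_take.comp (Primrec.snd.comp hindex) (Primrec.snd.comp hstring)))).to_comp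
  have htake_iff : ∀ x : ι × List Bool × List Bool, x.2 ∈ extensions {q | W (x.1, q)} ↔
      ∃ t : ℕ, W (x.1, x.2.1.take t.unpair.1, x.2.2.take t.unpair.2) := fun x => by
    constructor
    · rintro ⟨⟨a, b⟩, hab, ha, hb⟩
      refine ⟨Nat.pair a.length b.length, ?_⟩
      rw [Nat.unpair_pair, ← List.prefix_iff_eq_take.1 ha, ← List.prefix_iff_eq_take.1 hb]
      exact hab
    · rintro ⟨t, ht⟩
      exact ⟨_, ht, List.take_prefix _ _, List.take_prefix _ _⟩
  simpa only [htake_iff] using hW.exists_comp htake.computableIn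

theorem ComputableMeasure.lowerSemicomputable_preimage {P : Measure (Cantor × Cantor)}
    [IsFiniteMeasure P] (hP : ComputableMeasure P) {E : ι × List Bool × List Bool → Prop}
    (hE : REPredIn ∅ E) {n : ι → ℕ} (hn : Computable n) :
    LowerSemicomputable fun x => P (initSegPair (n x) ⁻¹' {p | E (x, p)}) := by
  have hlength : ComputablePred fun z : ι × List Bool × List Bool =>
      z.2.1.length = n z.1 ∧ z.2.2.length = n z.1 := by
    have heq : Computable₂ fun a b : ℕ => decide (a = b) := Primrec.eq.decide.to_comp
    have hbound : Computable fun z : ι × List Bool × List Bool => n z.1 := hn.comp Computable.fst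
    refine ⟨inferInstance, (Primrec.and.to_comp.comp
      (heq.comp (Computable.list_length.comp (Computable.fst.comp Computable.snd)) hbound)
      (heq.comp (Computable.list_length.comp (Computable.snd.comp Computable.snd)) hbound)).of_eq
      fun z => ?_⟩
    exact (Bool.decide_and _ _).symm
  simp only [measure_preimage_initSegPair]
  exact ((hP.lowerSemicomputable.comp Computable.snd).indicator
    (hE.and (REPredIn.of_computablePred hlength))).tsum

end EffectiveStrings

section PrefixMinimal

/-- The members of `S` without a proper prefix in `S`. Their intervals are disjoint and cover the
same sequences as the intervals of all members of `S`. -/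
def prefixMinimal (S : Set (List Bool)) : Set (List Bool) :=
  {a ∈ S | ∀ b ∈ S, b <+: a → b = a}

theorem biUnion_prefixMinimal (S : Set (List Bool)) :
    ⋃ a ∈ prefixMinimal S, cyl a = ⋃ a ∈ S, cyl a := by
  classical
  refine Set.Subset.antisymm (Set.biUnion_subset_biUnion_left fun a ha => ha.1) fun α hα => ?_
  obtain ⟨a, haS, hαa⟩ := Set.mem_iUnion₂.1 hα
  have hprefix : ∃ n, initSeg α n ∈ S := ⟨a.length, (initSeg_eq_iff.2 ⟨rfl, hαa⟩).symm ▸ haS⟩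
  refine Set.mem_iUnion₂.2 ⟨initSeg α (Nat.find hprefix), ⟨Nat.find_spec hprefix, ?_⟩,
    mem_cyl_initSeg α _⟩
  intro b hbS hb
  have hbα : initSeg α b.length = b := initSeg_eq_iff.2 ⟨rfl, (prefix_initSeg_iff.1 hb).2⟩
  refine hb.eq_of_length_le ?_
  rw [length_initSeg]
  exact Nat.find_min' hprefix (hbα.symm ▸ hbS)

theorem pairwiseDisjoint_prefixMinimal (S : Set (List Bool)) :
    (prefixMinimal S).PairwiseDisjoint cyl := by
  intro a ha b hb hab
  refine Set.disjoint_left.2 fun α hαa hαb => hab ?_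
  have hαa' : initSeg α a.length = a := initSeg_eq_iff.2 ⟨rfl, hαa⟩
  have hαb' : initSeg α b.length = b := initSeg_eq_iff.2 ⟨rfl, hαb⟩
  rcases le_total a.length b.length with h | h
  · exact hb.2 a ha.1 (hαb' ▸ prefix_initSeg_iff.2 ⟨h, hαa⟩)
  · exact (ha.2 b hb.1 (hαa' ▸ prefix_initSeg_iff.2 ⟨h, hαb⟩)).symm

theorem measure_biUnion_cyl_le {μ ν : Measure Cantor} {S : Set (List Bool)}
    (h : ∀ a ∈ S, μ (cyl a) ≤ ν (cyl a)) : μ (⋃ a ∈ S, cyl a) ≤ ν (⋃ a ∈ S, cyl a) := by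
  rw [← biUnion_prefixMinimal,
    measure_biUnion (Set.to_countable _) (pairwiseDisjoint_prefixMinimal S)
      fun a _ => measurableSet_cyl a,
    measure_biUnion (Set.to_countable _) (pairwiseDisjoint_prefixMinimal S)
      fun a _ => measurableSet_cyl a]
  exact ENNReal.tsum_le_tsum fun a => h a a.2.1

end PrefixMinimal

section HeavyIntervals

/-- The conditional probability of `U` given the strip `[a] × Ω` exceeds `1 / c`. The inequality is
multiplied out, so an interval `[a]` of measure zero is never heavy. -/
def IsHeavy (P : Measure (Cantor × Cantor)) (U : Set (Cantor × Cantor)) (c : ℝ≥0∞)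
    (a : List Bool) : Prop :=
  P.fst (cyl a) < c * P (U ∩ Prod.fst ⁻¹' cyl a)

theorem fst_biUnion_isHeavy_le (P : Measure (Cantor × Cantor)) (U : Set (Cantor × Cantor))
    (c : ℝ≥0∞) : P.fst (⋃ a ∈ {a | IsHeavy P U c a}, cyl a) ≤ c * P U := by
  have hle : ∀ a ∈ {a | IsHeavy P U c a}, P.fst (cyl a) ≤ (c • (P.restrict U).fst) (cyl a) := by
    intro a ha
    rw [Measure.smul_apply, smul_eq_mul,
      Measure.fst_apply (ρ := P.restrict U) (measurableSet_cyl a),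
      Measure.restrict_apply (measurable_fst (measurableSet_cyl a)), Set.inter_comm]
    exact ha.le
  refine (measure_biUnion_cyl_le hle).trans ((measure_mono (Set.subset_univ _)).trans_eq ?_)
  rw [Measure.smul_apply, smul_eq_mul, Measure.fst_univ, Measure.restrict_apply_univ]

theorem isHeavy_openSet_iff {P : Measure (Cantor × Cantor)} {W : ℕ × List Bool × List Bool → Prop}
    {m : ℕ} {c : ℝ≥0∞} {a : List Bool} :
    IsHeavy P (openSet box W m) c a ↔ ∃ n, P (box (a, [])) <
      c * P (initSegPair n ⁻¹' (extensions {q | W (m, q)} ∩ extensions {(a, [])})) := by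
  have hinter : P (openSet box W m ∩ Prod.fst ⁻¹' cyl a) =
      ⨆ n, P (initSegPair n ⁻¹' (extensions {q | W (m, q)} ∩ extensions {(a, [])})) := by
    rw [← measure_biUnion_box_inter, openSet_eq_biUnion, Set.biUnion_singleton, box_nil_right]
  rw [IsHeavy, hinter, ENNReal.mul_iSup, lt_iSup_iff, Measure.fst_apply (measurableSet_cyl a),
    box_nil_right]

theorem ComputableMeasure.rePredIn_isHeavy {P : Measure (Cantor × Cantor)} [IsFiniteMeasure P]
    (hP : ComputableMeasure P) {W : ℕ × List Bool × List Bool → Prop} (hW : REPredIn ∅ W) :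
    REPredIn ∅ fun x : (ℕ × ℕ) × List Bool => IsHeavy P (openSet box W x.1.1) (2 ^ x.1.2) x.2 := by
  have hopen : REPredIn ∅ fun z : (((ℕ × ℕ) × List Bool) × ℕ) × List Bool × List Bool =>
      z.2 ∈ extensions {q | W (z.1.1.1.1, q)} :=
    (hW.comp (((Primrec.fst.comp (Primrec.fst.comp (Primrec.fst.comp Primrec.fst))).pair
      Primrec.snd).computableIn)).mem_extensions
  have hstrip : REPredIn ∅ fun z : (((ℕ × ℕ) × List Bool) × ℕ) × List Bool × List Bool =>
      z.2 ∈ extensions {(z.1.1.2, [])} :=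
    (REPredIn.of_computablePred (PrimrecPred.computablePred (Primrec.eq.comp Primrec.snd
      ((Primrec.snd.comp (Primrec.fst.comp Primrec.fst)).pair (Primrec.const []))))).mem_extensions
  have hupper : UpperSemicomputable fun y : ((ℕ × ℕ) × List Bool) × ℕ => P (box (y.1.2, [])) :=
    hP.upperSemicomputable.comp
      ((Computable.snd.comp Computable.fst).pair (Computable.const []))
  have hlower : LowerSemicomputable fun y : ((ℕ × ℕ) × List Bool) × ℕ => 2 ^ y.1.1.2 *
      P (initSegPair y.2 ⁻¹' (extensions {q | W (y.1.1.1, q)} ∩ extensions {(y.1.2, [])})) :=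
    (hP.lowerSemicomputable_preimage (hopen.and hstrip) Computable.snd).two_pow_mul
      (Computable.snd.comp (Computable.fst.comp Computable.fst))
  simp only [isHeavy_openSet_iff]
  exact (hupper.rePredIn_lt hlower).exists_comp (g := fun z => z) ComputableIn.id

/-- The family of test sets on the first coordinate: its `N`-th member is the union of the intervals
`[a]` with `P (U (2 * m) | [a] × Ω) > 2 ^ (-m)` for some `m > N`, where `U` is the family of open
sets given by `W`. -/
def heavyFamily (P : Measure (Cantor × Cantor)) (W : ℕ × List Bool × List Bool → Prop) :
    ℕ × List Bool → Prop :=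
  fun x => ∃ j, IsHeavy P (openSet box W (2 * (x.1 + 1 + j))) (2 ^ (x.1 + 1 + j)) x.2

theorem openSet_heavyFamily (P : Measure (Cantor × Cantor)) (W : ℕ × List Bool × List Bool → Prop)
    (N : ℕ) : openSet cyl (heavyFamily P W) N = ⋃ j, ⋃ a ∈ {a | IsHeavy P
      (openSet box W (2 * (N + 1 + j))) (2 ^ (N + 1 + j)) a}, cyl a := by
  ext α
  simp only [openSet, heavyFamily, Set.mem_iUnion, Set.mem_ofPred_eq, exists_prop]
  exact ⟨fun ⟨a, ⟨j, ha⟩, hα⟩ => ⟨j, a, ha, hα⟩, fun ⟨j, a, ha, hα⟩ => ⟨a, ⟨j, ha⟩, hα⟩⟩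

theorem two_pow_mul_le_of_le {x : ℝ≥0∞} {n : ℕ} (hx : x ≤ 2⁻¹ ^ (2 * n)) : 2 ^ n * x ≤ 2⁻¹ ^ n := by
  refine (mul_le_mul_right hx _).trans_eq ?_
  rw [two_mul, pow_add, ← mul_assoc, ← mul_pow, ENNReal.mul_inv_cancel two_ne_zero
    ENNReal.ofNat_ne_top, one_pow, one_mul]

theorem tsum_two_inv_pow_add (N : ℕ) : ∑' j, (2⁻¹ : ℝ≥0∞) ^ (N + 1 + j) = 2⁻¹ ^ N := by
  have hcomm : ∀ j, N + 1 + j = N + (j + 1) := fun j => by omega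
  simp only [hcomm, pow_add _ N, ENNReal.tsum_mul_left, ENNReal.tsum_geometric_add_one,
    ENNReal.one_sub_inv_two, inv_inv]
  rw [ENNReal.inv_mul_cancel two_ne_zero ENNReal.ofNat_ne_top, mul_one]

theorem isTest_heavyFamily {P : Measure (Cantor × Cantor)} [IsFiniteMeasure P]
    (hP : ComputableMeasure P) {W : ℕ × List Bool × List Bool → Prop} (hW : IsTest box ∅ P W) :
    IsTest cyl ∅ P.fst (heavyFamily P W) where
  enumerable := by
    have hindex : Primrec fun z : (ℕ × List Bool) × ℕ => z.1.1 + 1 + z.2 :=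
      Primrec.nat_add.comp (Primrec.succ.comp (Primrec.fst.comp Primrec.fst)) Primrec.snd
    exact (hP.rePredIn_isHeavy hW.enumerable).exists_comp
      (((Primrec.nat_mul.comp (Primrec.const 2) hindex).pair hindex).pair
        (Primrec.snd.comp Primrec.fst)).computableIn
  measure_le N := by
    rw [openSet_heavyFamily]
    calc P.fst (⋃ j, ⋃ a ∈ {a | IsHeavy P (openSet box W (2 * (N + 1 + j))) (2 ^ (N + 1 + j)) a},
          cyl a)
        ≤ ∑' j, 2 ^ (N + 1 + j) * P (openSet box W (2 * (N + 1 + j))) :=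
          (measure_iUnion_le _).trans (ENNReal.tsum_le_tsum fun j => fst_biUnion_isHeavy_le _ _ _)
      _ ≤ ∑' j, 2⁻¹ ^ (N + 1 + j) :=
          ENNReal.tsum_le_tsum fun j => two_pow_mul_le_of_le (hW.measure_le _)
      _ = 2⁻¹ ^ N := tsum_two_inv_pow_add N

end HeavyIntervals

section Conditional

/-- The sections at `α` of the open sets given by `W`, as a family of unions of intervals. -/
def sectionFamily (W : ℕ × List Bool × List Bool → Prop) (α : Cantor) : ℕ × List Bool → Prop :=
  fun x => ∃ k, W (x.1, initSeg α k, x.2)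

theorem openSet_sectionFamily (W : ℕ × List Bool × List Bool → Prop) (α : Cantor) (n : ℕ) :
    openSet cyl (sectionFamily W α) n = Prod.mk α ⁻¹' openSet box W n := by
  ext β
  constructor
  · rintro ⟨b, ⟨k, hk⟩, hβ⟩
    exact ⟨(initSeg α k, b), hk, mem_cyl_initSeg α k, hβ⟩
  · rintro ⟨⟨a, b⟩, hab, hα, hβ⟩
    exact ⟨b, ⟨a.length, (initSeg_eq_iff.2 ⟨rfl, hα⟩).symm ▸ hab⟩, hβ⟩

theorem rePredIn_sectionFamily {W : ℕ × List Bool × List Bool → Prop} (hW : REPredIn ∅ W)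
    (α : Cantor) : REPredIn {oracle α} (sectionFamily W α) :=
  hW.exists_comp (computableIn_pair (computableIn_comp ComputableIn.fst ComputableIn.fst)
    (computableIn_pair (computableIn_comp (computableIn_initSeg α) ComputableIn.snd)
      (computableIn_comp ComputableIn.snd ComputableIn.fst)))

theorem preimage_initSeg_eq_biUnion (n : ℕ) (S : Set (List Bool)) :
    (initSeg · n) ⁻¹' S =
      ⋃ b ∈ ((List.finite_length_eq Bool n).inter_of_left S).toFinset, cyl b := by
  ext β
  simp only [Set.mem_preimage, Set.Finite.mem_toFinset, Set.mem_inter_iff, Set.mem_ofPred_eq,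
    Set.mem_iUnion, exists_prop]
  constructor
  · exact fun hβ => ⟨_, ⟨length_initSeg β n, hβ⟩, mem_cyl_initSeg β n⟩
  · rintro ⟨b, ⟨hbn, hbS⟩, hβ⟩
    exact (initSeg_eq_iff.2 ⟨hbn, hβ⟩).symm ▸ hbS

theorem measurableSet_preimage_initSeg (n : ℕ) (S : Set (List Bool)) :
    MeasurableSet ((initSeg · n) ⁻¹' S) := by
  rw [preimage_initSeg_eq_biUnion]
  exact Finset.measurableSet_biUnion _ fun b _ => measurableSet_cyl b

theorem measure_preimage_initSeg (μ : Measure Cantor) (n : ℕ) (S : Set (List Bool)) :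
    μ ((initSeg · n) ⁻¹' S) =
      ∑ b ∈ ((List.finite_length_eq Bool n).inter_of_left S).toFinset, μ (cyl b) := by
  rw [preimage_initSeg_eq_biUnion]
  refine measure_biUnion_finset (fun a ha b hb hab => Set.disjoint_left.2 fun β hβa hβb => hab ?_)
    fun b _ => measurableSet_cyl b
  simp only [Finset.mem_coe, Set.Finite.mem_toFinset, Set.mem_inter_iff, Set.mem_ofPred_eq]
    at ha hb
  exact (initSeg_eq_iff.2 ⟨ha.1, hβa⟩).symm.trans (initSeg_eq_iff.2 ⟨hb.1, hβb⟩)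

theorem tendsto_measure_preimage_initSeg {ι : Type*} {l : Filter ι} {μ : ι → Measure Cantor}
    {ν : Measure Cantor} (h : ∀ b, Tendsto (fun i => μ i (cyl b)) l (𝓝 (ν (cyl b)))) (n : ℕ)
    (S : Set (List Bool)) :
    Tendsto (fun i => μ i ((initSeg · n) ⁻¹' S)) l (𝓝 (ν ((initSeg · n) ⁻¹' S))) := by
  simp only [measure_preimage_initSeg]
  exact tendsto_finsetSum _ fun b _ => h b

theorem IsCondMeasure.tendsto_cond {P : Measure (Cantor × Cantor)} {α : Cantor} {Q : Measure Cantor}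
    (hQ : IsCondMeasure P α Q) (b : List Bool) :
    Tendsto (fun k => (ProbabilityTheory.cond P (Prod.fst ⁻¹' cyl (initSeg α k))).snd (cyl b)) atTop
      (𝓝 (Q (cyl b))) := by
  refine (hQ.tendsto b).congr fun k => ?_
  rw [Measure.snd_apply (measurableSet_cyl b),
    ProbabilityTheory.cond_apply (measurable_fst (measurableSet_cyl _)),
    Measure.fst_apply (measurableSet_cyl _), ENNReal.div_eq_inv_mul]
  rfl

theorem cond_le_inv_of_not_isHeavy {P : Measure (Cantor × Cantor)}
    {U : Set (Cantor × Cantor)} {c : ℝ≥0∞} {a : List Bool} (h : ¬ IsHeavy P U c a) :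
    ProbabilityTheory.cond P (Prod.fst ⁻¹' cyl a) U ≤ c⁻¹ := by
  have hstrip : MeasurableSet (Prod.fst ⁻¹' cyl a : Set (Cantor × Cantor)) :=
    measurable_fst (measurableSet_cyl a)
  rw [IsHeavy, not_lt, Measure.fst_apply (measurableSet_cyl a)] at h
  rw [ProbabilityTheory.cond_apply hstrip, ENNReal.le_inv_iff_mul_le, Set.inter_comm, mul_assoc,
    mul_comm _ c]
  exact (mul_le_mul_right h _).trans (ENNReal.inv_mul_le_one _)

theorem mem_biUnion_box_of_mem_cyl_initSeg {D : Set (List Bool × List Bool)} {α α' β : Cantor}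
    {n k : ℕ} (hnk : n ≤ k) (hα' : α' ∈ cyl (initSeg α k))
    (hβ : initSegPair n (α, β) ∈ extensions D) : (α', β) ∈ ⋃ q ∈ D, box q := by
  obtain ⟨q, hq, ⟨hqn, -⟩, hqα, hqβ⟩ := initSegPair_mem_extensions_iff.1 hβ
  have hα'k : initSeg α' k = initSeg α k := initSeg_eq_iff.2 ⟨length_initSeg α k, hα'⟩
  have hqα' : q.1 <+: initSeg α' k := hα'k ▸ prefix_initSeg_iff.2 ⟨hqn.trans hnk, hqα⟩
  exact Set.mem_biUnion hq ⟨(prefix_initSeg_iff.1 hqα').2, hqβ⟩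

theorem IsCondMeasure.measure_section_le {P : Measure (Cantor × Cantor)} {α : Cantor}
    {Q : Measure Cantor} (hQ : IsCondMeasure P α Q) {D : Set (List Bool × List Bool)} {c : ℝ≥0∞}
    (hα : ∀ k, ¬ IsHeavy P (⋃ q ∈ D, box q) c (initSeg α k)) :
    Q (Prod.mk α ⁻¹' ⋃ q ∈ D, box q) ≤ c⁻¹ := by
  have hmono : Monotone fun n => Prod.mk α ⁻¹' (initSegPair n ⁻¹' extensions D) :=
    fun m n hmn => Set.preimage_mono (monotone_preimage_extensions D hmn)
  rw [← iUnion_preimage_extensions, Set.preimage_iUnion, hmono.measure_iUnion]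
  refine iSup_le fun n => le_of_tendsto (tendsto_measure_preimage_initSeg hQ.tendsto_cond n
    {b | (initSeg α n, b) ∈ extensions D}) ?_
  filter_upwards [eventually_ge_atTop n] with k hk
  set strip : Set (Cantor × Cantor) := Prod.fst ⁻¹' cyl (initSeg α k)
  have hstrip : MeasurableSet strip := measurable_fst (measurableSet_cyl _)
  calc (ProbabilityTheory.cond P strip).snd
        ((initSeg · n) ⁻¹' {b | (initSeg α n, b) ∈ extensions D})
      = ProbabilityTheory.cond P strip
          (Prod.snd ⁻¹' ((initSeg · n) ⁻¹' {b | (initSeg α n, b) ∈ extensions D})) :=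
        Measure.snd_apply (measurableSet_preimage_initSeg n _)
    _ ≤ ProbabilityTheory.cond P strip (⋃ q ∈ D, box q) := by
        rw [← ProbabilityTheory.cond_inter_self hstrip]
        exact measure_mono fun x hx => mem_biUnion_box_of_mem_cyl_initSeg hk hx.1 hx.2
    _ ≤ c⁻¹ := cond_le_inv_of_not_isHeavy (hα k)

theorem exists_isCondMeasure_of_blindRandom {P : Measure (Cantor × Cantor)} {α β : Cantor}
    (h : BlindRandom α (condMeasure P α) β) : ∃ Q, IsCondMeasure P α Q := by
  by_contra hex
  rw [condMeasure, dif_neg hex] at h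
  exact not_blindRandom_zero α β h

theorem isTest_sectionFamily {P : Measure (Cantor × Cantor)}
    {W : ℕ × List Bool × List Bool → Prop} (hW : REPredIn ∅ W) {N : ℕ} {α : Cantor}
    (hα : α ∉ openSet cyl (heavyFamily P W) N) {Q : Measure Cantor} (hQ : IsCondMeasure P α Q) :
    IsTest cyl {oracle α} Q (sectionFamily (fun x => W (2 * (N + 1 + x.1), x.2)) α) where
  enumerable := rePredIn_sectionFamily (hW.comp (Primrec.pair (Primrec.nat_mul.comp
    (Primrec.const 2) (Primrec.nat_add.comp (Primrec.const (N + 1)) Primrec.fst))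
      Primrec.snd).computableIn) α
  measure_le j := by
    have hlight : ∀ k,
        ¬ IsHeavy P (openSet box W (2 * (N + 1 + j))) (2 ^ (N + 1 + j)) (initSeg α k) :=
      fun k hk => hα ⟨initSeg α k, ⟨j, hk⟩, mem_cyl_initSeg α k⟩
    rw [openSet_eq_biUnion] at hlight
    rw [openSet_sectionFamily, openSet_eq_biUnion]
    refine (hQ.measure_section_le hlight).trans ?_
    rw [ENNReal.inv_pow]
    exact pow_le_pow_right_of_le_one' (ENNReal.inv_le_one.2 one_le_two) (Nat.le_add_left j (N + 1))

end Conditional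

end VanLambalgen

theorem mainTheorem3 (P : MeasureTheory.Measure (VanLambalgen.Cantor × VanLambalgen.Cantor))
    [MeasureTheory.IsProbabilityMeasure P] (hP : VanLambalgen.ComputableMeasure P)
    (α₁ α₂ : VanLambalgen.Cantor)
    (h₁ : VanLambalgen.MLRandom P.fst α₁)
    (h₂ : VanLambalgen.BlindRandom α₁ (VanLambalgen.condMeasure P α₁) α₂) :
    VanLambalgen.MLRandomPair P (α₁, α₂) := by
  intro W hW
  obtain ⟨N, hN⟩ := h₁ _ (VanLambalgen.isTest_heavyFamily hP hW)
  obtain ⟨Q, hQ⟩ := VanLambalgen.exists_isCondMeasure_of_blindRandom h₂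
  rw [VanLambalgen.condMeasure_eq hQ] at h₂
  obtain ⟨j, hj⟩ := h₂ _ (VanLambalgen.isTest_sectionFamily hW.enumerable hN hQ)
  rw [VanLambalgen.openSet_sectionFamily] at hj
  exact ⟨2 * (N + 1 + j), hj⟩
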